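/- Conventions. All filters on $\omega$ are proper and contain the cofinite sets; for such a filter $F$ let $I=\{\omega\setminus A: A\in F\}$ be the dual ideal. $F$ is a \emph{P-filter} if for all $A_n\in F$ ($n<\omega$) there is $B\in F$ with $B\setminus A_n$ finite for every $n$; it is \emph{ccc} if every family of sets $S\subseteq\omega$ with $S\notin I$ whose pairwise intersections lie in $I$ is countable. A \emph{tree} is a partial order $(T,\le_T)$ with $T\subseteq\omega$ such that the predecessors of each element are linearly ordered and $i\le_T j$ implies $i\le j$; a \emph{branch} is a maximal linearly ordered subset. Write $T\le_t S$ if $(S,\le_S)$ is a subordering of $(T,\le_T)$ and each branch of $T$ contains cofinally a unique branch of $S$. Let $T^{(n)}$ be $T$ with the numbers $\le n$ deleted. Let $F$ be a ccc P-filter on $\omega$ and fix a tree $T_0$ with $T_0\in I$ (as a set) that is order isomorphic to the full binary tree of height $\omega$. Let $\mathbf P(F)$ be the forcing of all pairs $p=\langle T_p,f_p\rangle$, where $T_p\in I$ is a tree with $T_p\le_t T_0^{(n)}$ for some $n$, and $f_p:T_p\to\{0,1\}$, ordered by: $p\le q$ iff $T_p\le_t T_q$ and $f_p\supseteq f_q$.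 Let $\mathbf Q(F)$ be the full-support product of countably many copies of $\mathbf P(F)$. \textbf{Lemma.} Let $\mathbf R$ be an $\omega^\omega$-bounding forcing (that is, it is forced that every function $\omega\to\omega$ in $V^{\mathbf R}$ is eventually dominated by a function $\omega\to\omega$ in $V$) such that $\mathbf Q(F)$ is a complete subforcing of $\mathbf R$ (that is, there is a complete embedding of $\mathbf Q(F)$ into $\mathbf R$). Then in $V^{\mathbf R}$ the filter $F$ cannot be extended to a ccc P-filter: every condition of $\mathbf R$ forces that there is no ccc P-filter $E$ on $\omega$ with $F\subseteq E$. -/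

import Mathlib

/-! ## Trees on the natural numbers -/

/-- A tree: a partially ordered set `T ⊆ ω` in which predecessors of any element are linearly
ordered and `i ≤_T j` implies `i ≤ j` (hence `≤_T` is antisymmetric). The relation `le` holds
only between elements of the carrier. -/
structure NatTree where
  carrier : Set ℕ
  le : ℕ → ℕ → Prop
  le_mem : ∀ i j, le i j → i ∈ carrier ∧ j ∈ carrier
  le_refl : ∀ i ∈ carrier, le i i
  le_trans : ∀ i j k, le i j → le j k → le i k
  le_linear : ∀ i j k, le i k → le j k → le i j ∨ le j i
  le_nat : ∀ i j, le i j → i ≤ j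

namespace NatTree

/-- Branches are maximal linearly ordered subsets. -/
def IsBranch (T : NatTree) (b : Set ℕ) : Prop :=
  Maximal (fun c : Set ℕ => c ⊆ T.carrier ∧ IsChain T.le c) b

/-- `T ≤_t S`: `S` is a subordering of `T`, and every branch of `T` contains cofinally a unique
branch of `S`. -/
def Extends (T S : NatTree) : Prop :=
  S.carrier ⊆ T.carrier ∧
  (∀ i ∈ S.carrier, ∀ j ∈ S.carrier, S.le i j ↔ T.le i j) ∧
  ∀ B, T.IsBranch B → ∃! b, S.IsBranch b ∧ b ⊆ B ∧ ∀ i ∈ B, ∃ j ∈ b, T.le i j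

/-- `T^(n)`: the subtree obtained by deleting the numbers `≤ n`. -/
def delete (T : NatTree) (n : ℕ) : NatTree where
  carrier := {i | i ∈ T.carrier ∧ n < i}
  le i j := T.le i j ∧ n < i ∧ n < j
  le_mem i j h := ⟨⟨(T.le_mem i j h.1).1, h.2.1⟩, ⟨(T.le_mem i j h.1).2, h.2.2⟩⟩
  le_refl i h := ⟨T.le_refl i h.1, h.2, h.2⟩
  le_trans i j k h h' := ⟨T.le_trans i j k h.1 h'.1, h.2.1, h'.2.2⟩
  le_linear i j k h h' :=
    (T.le_linear i j k h.1 h'.1).imp (fun a => ⟨a, h.2.1, h'.2.1⟩) (fun a => ⟨a, h'.2.1, h.2.1⟩)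
  le_nat i j h := T.le_nat i j h.1

/-- `T` is order isomorphic to the full binary tree of height `ω`, that is, to the finite 0-1
sequences ordered by the initial-segment relation. -/
def IsFullBinary (T : NatTree) : Prop :=
  ∃ e : List Bool → ℕ, Set.BijOn e Set.univ T.carrier ∧ ∀ s t, T.le (e s) (e t) ↔ s <+: t

theorem Extends.refl (T : NatTree) : T.Extends T := by
  refine ⟨subset_rfl, fun _ _ _ _ => Iff.rfl, fun B hB => ⟨B, ⟨hB, subset_rfl, fun i hi =>
    ⟨i, hi, T.le_refl i (hB.prop.1 hi)⟩⟩, ?_⟩⟩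
  rintro b ⟨hb, hbB, -⟩
  exact Set.Subset.antisymm hbB (hb.le_of_ge hB.prop hbB)

theorem Extends.trans {T S U : NatTree} (h : T.Extends S) (h' : S.Extends U) : T.Extends U := by
  refine ⟨h'.1.trans h.1, fun i hi j hj =>
    (h'.2.1 i hi j hj).trans (h.2.1 i (h'.1 hi) j (h'.1 hj)), fun B hB => ?_⟩
  obtain ⟨c, ⟨hc, hcB, hcof⟩, -⟩ := h.2.2 B hB
  obtain ⟨b, ⟨hb, hbc, hbcof⟩, -⟩ := h'.2.2 c hc
  refine ⟨b, ⟨hb, hbc.trans hcB, fun i hi => ?_⟩, ?_⟩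
  · obtain ⟨j, hj, hij⟩ := hcof i hi
    obtain ⟨k, hk, hjk⟩ := hbcof j hj
    refine ⟨k, hk, T.le_trans _ _ _ hij ?_⟩
    exact (h.2.1 j (hc.prop.1 hj) k (hc.prop.1 (hbc hk))).1 hjk
  · rintro d ⟨hd, hdB, -⟩
    -- both `b` and `d` are maximal, and their union is still a chain inside `B`
    have hu : b ∪ d ⊆ U.carrier ∧ IsChain U.le (b ∪ d) := by
      refine ⟨Set.union_subset hb.prop.1 hd.prop.1, fun x hx y hy hxy => ?_⟩
      have hxU : x ∈ U.carrier := Set.union_subset hb.prop.1 hd.prop.1 hx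
      have hyU : y ∈ U.carrier := Set.union_subset hb.prop.1 hd.prop.1 hy
      have hT := hB.prop.2 (Set.union_subset (hbc.trans hcB) hdB hx)
        (Set.union_subset (hbc.trans hcB) hdB hy) hxy
      have tr : ∀ v ∈ U.carrier, ∀ w ∈ U.carrier, T.le v w → U.le v w := fun v hv w hw hvw =>
        (h'.2.1 v hv w hw).2 ((h.2.1 v (h'.1 hv) w (h'.1 hw)).2 hvw)
      exact hT.imp (tr x hxU y hyU) (tr y hyU x hxU)
    have h1 : b ∪ d ⊆ b := hb.le_of_ge hu Set.subset_union_left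
    have h2 : b ∪ d ⊆ d := hd.le_of_ge hu Set.subset_union_right
    exact Set.Subset.antisymm (Set.subset_union_right.trans h1) (Set.subset_union_left.trans h2)

end NatTree

/-! ## ccc P-filters and the forcings P(F) and Q(F) -/

/-- A ccc P-filter on `ω`: a proper filter containing all cofinite sets, such that countably many
members have a pseudo-intersection in the filter, and such that every family of positive sets
with pairwise intersections in the dual ideal is countable. -/
structure IsCccPFilter (F : Filter ℕ) : Prop where
  neBot : F.NeBot
  le_cofinite : F ≤ Filter.cofinite
  pseudo : ∀ A : ℕ → Set ℕ, (∀ n, A n ∈ F) → ∃ B ∈ F, ∀ n, (B \ A n).Finite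
  ccc : ∀ 𝒜 : Set (Set ℕ), (∀ S ∈ 𝒜, Sᶜ ∉ F) →
    (∀ S ∈ 𝒜, ∀ S' ∈ 𝒜, S ≠ S' → (S ∩ S')ᶜ ∈ F) → 𝒜.Countable

/-- Conditions of `P(F)` built from `T₀`: pairs `⟨T, f⟩`, where `T` is a tree in the dual ideal
of `F` with `T ≤_t T₀^(n)` for some `n`, and `f : T → {0,1}`. -/
structure PForcing (F : Filter ℕ) (T₀ : NatTree) where
  tree : NatTree
  small : tree.carrierᶜ ∈ F
  ext : ∃ n, tree.Extends (T₀.delete n)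
  f : tree.carrier → Bool

/-- `p ≤ q` iff `T_p ≤_t T_q` and `f_p` extends `f_q`. -/
instance (F : Filter ℕ) (T₀ : NatTree) : Preorder (PForcing F T₀) where
  le p q := p.tree.Extends q.tree ∧
    ∀ i (hp : i ∈ p.tree.carrier) (hq : i ∈ q.tree.carrier), p.f ⟨i, hp⟩ = q.f ⟨i, hq⟩
  le_refl p := ⟨NatTree.Extends.refl _, fun _ _ _ => rfl⟩
  le_trans _ _ _ h h' := ⟨h.1.trans h'.1, fun i hp hr =>
    (h.2 i hp (h'.1.1 hr)).trans (h'.2 i (h'.1.1 hr) hr)⟩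

/-- `Q(F)`: the full-support countable power of `P(F)`, ordered coordinatewise. -/
abbrev QForcing (F : Filter ℕ) (T₀ : NatTree) : Type := ℕ → PForcing F T₀

/-- Two conditions are compatible if they have a common extension. -/
def Compatible {R : Type*} [Preorder R] (p q : R) : Prop := ∃ r, r ≤ p ∧ r ≤ q

/-- `e` embeds `Q` into `R` as a complete subforcing: it preserves order and incompatibility, and
every `r ∈ R` has a reduction `q ∈ Q`, all of whose extensions are compatible with `r`. -/
structure IsCompleteEmbedding {Q R : Type*} [Preorder Q] [Preorder R] (e : Q → R) : Prop where
  mono : Monotone e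
  incompat : ∀ p q, ¬ Compatible p q → ¬ Compatible (e p) (e q)
  reduction : ∀ r : R, ∃ q : Q, ∀ q' ≤ q, Compatible (e q') r

/-! ## Names and the forcing relation

For a forcing `R` (stronger conditions are smaller), a name for a subset of a ground model set `α`
is a set of pairs `⟨a, p⟩` with `a ∈ α`, `p ∈ R`. A name for a set of subsets of `ω` is a set of
pairs `⟨τ, p⟩`, where `τ` is a name for a subset of `ω` and `p ∈ R`. Every subset of `α`, and every
set of subsets of `ω`, in the extension has a name of this form. A statement of the forcing
language is represented by the set of conditions forcing it; the clauses below are the usual ones.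
Quantifiers over the extension range over names; quantifiers over `ω`, or over a set of the ground
model, range over that set. -/

namespace Forcing

variable {R : Type*} [Preorder R]

/-- `p ⊩ φ` is written `φ p`. -/
abbrev Stmt (R : Type*) : Type _ := R → Prop

/-- An assertion about the ground model. -/
def lift (P : Prop) : Stmt R := fun _ => P

def and (φ ψ : Stmt R) : Stmt R := fun p => φ p ∧ ψ p

def not (φ : Stmt R) : Stmt R := fun p => ∀ q ≤ p, ¬ φ q

def imp (φ ψ : Stmt R) : Stmt R := fun p => ∀ q ≤ p, φ q → ψ q

def all {ι : Type*} (φ : ι → Stmt R) : Stmt R := fun p => ∀ x, φ x p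

/-- `p ⊩ ∃ x, φ x` iff the conditions forcing some `φ x` are dense below `p`. -/
def ex {ι : Type*} (φ : ι → Stmt R) : Stmt R := fun p => ∀ q ≤ p, ∃ r ≤ q, ∃ x, φ x r

/-- Names for subsets of the ground model set `α`. -/
abbrev SetName (R : Type*) (α : Type*) : Type _ := Set (α × R)

/-- Names for sets of subsets of `ω`. -/
abbrev FamilyName (R : Type*) : Type _ := Set (SetName R ℕ × R)

/-- The canonical name of a ground model set. -/
def check {α : Type*} (A : Set α) : SetName R α := {x | x.1 ∈ A}

/-- The statement `a ∈ τ`. -/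
def mem {α : Type*} (a : α) (τ : SetName R α) : Stmt R :=
  fun p => ∀ q ≤ p, ∃ r ≤ q, ∃ s, (a, s) ∈ τ ∧ r ≤ s

/-- The statement `σ ⊆ τ`. -/
def sub {α : Type*} (σ τ : SetName R α) : Stmt R := all fun a => imp (mem a σ) (mem a τ)

/-- The statement `σ = τ`. -/
def eq {α : Type*} (σ τ : SetName R α) : Stmt R := and (sub σ τ) (sub τ σ)

/-- The statement `σ ∈ E`. -/
def memFamily (σ : SetName R ℕ) (E : FamilyName R) : Stmt R :=
  fun p => ∀ q ≤ p, ∃ r ≤ q, ∃ τ s, (τ, s) ∈ E ∧ r ≤ s ∧ eq σ τ r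

/-- The statement `σ ⊆_* τ` (inclusion up to a finite set). -/
def almostSub (σ τ : SetName R ℕ) : Stmt R :=
  ex fun k : ℕ => all fun n : ℕ => imp (lift (k ≤ n)) (imp (mem n σ) (mem n τ))

/-- `E` is a proper filter on `ω` that contains all cofinite sets. -/
def isFilter (E : FamilyName R) : Stmt R :=
  and (all fun σ => imp (almostSub (check Set.univ) σ) (memFamily σ E)) <|
  and (all fun σ => all fun τ => imp (memFamily σ E) (imp (sub σ τ) (memFamily τ E))) <|
  and (all fun σ => all fun τ => imp (memFamily σ E) (imp (memFamily τ E)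
    (ex fun ρ => and (memFamily ρ E) (and (sub ρ σ) (sub ρ τ))))) <|
  all fun σ => imp (memFamily σ E) (ex fun n => mem n σ)

/-- Every sequence of members of `E` has a pseudo-intersection in `E`. (A name for a sequence of
subsets of `ω` amounts to a sequence of names.) -/
def isP (E : FamilyName R) : Stmt R :=
  all fun σ : ℕ → SetName R ℕ => imp (all fun n => memFamily (σ n) E)
    (ex fun ρ => and (memFamily ρ E) (all fun n => almostSub ρ (σ n)))

/-- `σ` is `E`-positive: it meets every member of `E`. -/
def positive (E : FamilyName R) (σ : SetName R ℕ) : Stmt R :=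
  all fun ρ => imp (memFamily ρ E) (ex fun n => and (mem n ρ) (mem n σ))

/-- `σ ∩ τ` is in the dual ideal of `E`: it is disjoint from some member of `E`. -/
def interNull (E : FamilyName R) (σ τ : SetName R ℕ) : Stmt R :=
  ex fun ρ => and (memFamily ρ E) (all fun n => not (and (mem n ρ) (and (mem n σ) (mem n τ))))

/-- The family `A` is countable: it is covered by a sequence of subsets of `ω`. -/
def countable (A : FamilyName R) : Stmt R :=
  ex fun ν : ℕ → SetName R ℕ => all fun σ => imp (memFamily σ A) (ex fun n => eq σ (ν n))

/-- Every family of `E`-positive sets with pairwise intersections in the dual ideal of `E` is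
countable. -/
def isCcc (E : FamilyName R) : Stmt R :=
  all fun A : FamilyName R =>
    imp (all fun σ => imp (memFamily σ A) (positive E σ)) <|
    imp (all fun σ => all fun τ => imp (memFamily σ A) (imp (memFamily τ A)
      (imp (not (eq σ τ)) (interNull E σ τ)))) <|
    countable A

/-- `E` is a ccc P-filter. -/
def isCccPFilter (E : FamilyName R) : Stmt R := and (isFilter E) (and (isP E) (isCcc E))

/-- `F ⊆ E`, where `F` is a filter of the ground model. -/
def extendsFilter (F : Filter ℕ) (E : FamilyName R) : Stmt R :=
  all fun A : {A : Set ℕ // A ∈ F} => memFamily (check A.1) E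

/-- `f` is a function from `ω` to `ω`. -/
def isFunction (f : SetName R (ℕ × ℕ)) : Stmt R :=
  and (all fun n : ℕ => ex fun m : ℕ => mem (n, m) f)
    (all fun n : ℕ => all fun m : ℕ => all fun k : ℕ =>
      imp (mem (n, m) f) (imp (mem (n, k) f) (lift (m = k))))

/-- `f ≤* g`, where `g` is a function of the ground model. -/
def dominatedBy (f : SetName R (ℕ × ℕ)) (g : ℕ → ℕ) : Stmt R :=
  ex fun k : ℕ => all fun n : ℕ => all fun m : ℕ =>
    imp (lift (k ≤ n)) (imp (mem (n, m) f) (lift (m ≤ g n)))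

/-- `R` is `ω^ω`-bounding: it is forced that the functions `ω → ω` of the ground model dominate. -/
def IsOmegaBounding (R : Type*) [Preorder R] : Prop :=
  ∀ p : R, (all fun f : SetName R (ℕ × ℕ) =>
    imp (isFunction f) (ex fun g : ℕ → ℕ => dominatedBy f g)) p

end Forcing

/-! Suppose a ccc P-filter `E` in the extension contains `F`. The generic object for `QForcing F T₀`
is a sequence of trees, and each ground model real `x` traces a branch through every one of them. In
a fixed tree, distinct reals give branches with bounded intersection, so by ccc only countably many
of these branches are `E`-positive. Bounding keeps the ground model reals uncountable
(`exists_real_omitted`), hence a single `x` has its branches in the dual ideal for all trees at once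
(`exists_null_branch`). The P-property gives `ρ` in `E` meeting the `n`-th of these branches only
below some number, and bounding yields a ground model `h` such that `h n` is such a number for
almost all `n`.

Genericity contradicts this (`exists_intervals`). The trees of a condition are small, so some `B ∈
F` is almost disjoint from all of them; finitely many new nodes can be put on any branch
(`exists_insert_finset`), so successive intervals of `B`, the `n`-th starting above `h n`, can be
forced into the `n`-th branch. Then `ρ` is disjoint from almost all intervals of `B`, so `ρ ∩ B` is
bounded although both sets are in `E`. -/

/-! ### Branches given by ground model reals. -/

namespace NatTree

/-- The branch of a copy `e` of the binary tree determined by `x`. -/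
def path (e : List Bool → ℕ) (x : ℕ → Bool) (j : ℕ) : ℕ := e ((List.range j).map x)

/-- The elements of `T` that lie below almost all nodes of the path `b`. -/
def below (T : NatTree) (b : ℕ → ℕ) : Set ℕ := {i | ∃ N, ∀ j ≥ N, T.le i (b j)}

theorem prefix_of_le (x : ℕ → Bool) {j k : ℕ} (h : j ≤ k) :
    (List.range j).map x <+: (List.range k).map x := by
  apply List.IsPrefix.map
  rw [List.prefix_iff_eq_take]
  simp [List.take_range, h]

theorem eq_of_prefix {x y : ℕ → Bool} {j k l : ℕ} (hl : l < j)
    (h : (List.range j).map x <+: (List.range k).map y) : x l = y l := by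
  have hl' : l < ((List.range j).map x).length := by simpa using hl
  have := h.getElem hl'
  simpa using this

theorem below_mono {S T : NatTree} (h : T.Extends S) (b : ℕ → ℕ) : S.below b ⊆ T.below b := by
  rintro i ⟨N, hN⟩
  refine ⟨N, fun j hj => ?_⟩
  have := S.le_mem _ _ (hN j hj)
  exact (h.2.1 _ this.1 _ this.2).1 (hN j hj)

section Path

variable {T₀ : NatTree} {e : List Bool → ℕ}

theorem path_mem (he : Set.BijOn e Set.univ T₀.carrier) (x : ℕ → Bool) (j : ℕ) :
    path e x j ∈ T₀.carrier := he.mapsTo (Set.mem_univ _)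

theorem path_strictMono (he : Set.BijOn e Set.univ T₀.carrier)
    (hle : ∀ s t, T₀.le (e s) (e t) ↔ s <+: t) (x : ℕ → Bool) : StrictMono (path e x) := by
  intro j k hjk
  refine lt_of_le_of_ne (T₀.le_nat _ _ ((hle _ _).2 (prefix_of_le x hjk.le))) fun h => ?_
  have := congrArg List.length (he.injOn (Set.mem_univ _) (Set.mem_univ _) h)
  simp at this
  omega

theorem path_le (he : Set.BijOn e Set.univ T₀.carrier)
    (hle : ∀ s t, T₀.le (e s) (e t) ↔ s <+: t) {T : NatTree} {m : ℕ}
    (hT : T.Extends (T₀.delete m)) (x : ℕ → Bool) {j k : ℕ} (hm : m < path e x j) (hjk : j ≤ k) :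
    T.le (path e x j) (path e x k) := by
  have hk : m < path e x k := hm.trans_le ((path_strictMono he hle x).monotone hjk)
  exact (hT.2.1 _ ⟨path_mem he x j, hm⟩ _ ⟨path_mem he x k, hk⟩).1
    ⟨(hle _ _).2 (prefix_of_le x hjk), hm, hk⟩

/-- Distinct branches have bounded intersection. -/
theorem below_inter_bounded (he : Set.BijOn e Set.univ T₀.carrier)
    (hle : ∀ s t, T₀.le (e s) (e t) ↔ s <+: t) {x y : ℕ → Bool} (hxy : x ≠ y) (m : ℕ) :
    ∃ N, ∀ T : NatTree, T.Extends (T₀.delete m) →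
      ∀ i ∈ T.below (path e x), i ∈ T.below (path e y) → i < N := by
  obtain ⟨l, hl⟩ := Function.ne_iff.1 hxy
  -- Level `l + 1` is past the splitting of `x` and `y`; level `m + 1` makes the node exceed `m`, so
  -- that it survives in `T₀.delete m`.
  set j := max (l + 1) (m + 1) with hj
  have hm : m < path e x j :=
    lt_of_lt_of_le (by omega) ((path_strictMono he hle x).le_apply (x := j))
  refine ⟨path e x j + 1, fun T hT i ⟨N₁, h₁⟩ ⟨N₂, h₂⟩ => ?_⟩
  set k := max j (max N₁ N₂) with hk
  have hi₁ := h₁ k (by omega)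
  have hi₂ := h₂ k (by omega)
  have hmy : m < path e y k :=
    lt_of_lt_of_le (by omega) ((path_strictMono he hle y).le_apply (x := k))
  rcases T.le_linear _ _ _ hi₁ (path_le he hle hT x hm (by omega : j ≤ k)) with h | h
  · exact Nat.lt_succ_of_le (T.le_nat _ _ h)
  · have h3 := (hT.2.1 _ ⟨path_mem he x j, hm⟩ _ ⟨path_mem he y k, hmy⟩).2
      (T.le_trans _ _ _ h hi₂)
    exact absurd (eq_of_prefix (by omega : l < j) ((hle _ _).1 h3.1)) hl

end Path

/-! ### Inserting one node into a tree. -/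

/-- Insert a new number `i` into `T` on the way to the node `c > i`. -/
def insertBelow (T : NatTree) (i c : ℕ) (hi : i ∉ T.carrier) : NatTree where
  carrier := insert i T.carrier
  -- The chain of nodes below `c` is cut at the number `i`: the smaller ones go below `i`, the
  -- larger ones and everything over them above `i`.
  le u v := T.le u v ∨ (u = i ∧ v = i) ∨ (u = i ∧ ∃ y, T.le y c ∧ i < y ∧ T.le y v) ∨
    (v = i ∧ T.le u c ∧ u < i)
  le_mem := by
    rintro u v (h | ⟨rfl, rfl⟩ | ⟨rfl, y, -, -, h⟩ | ⟨rfl, h, -⟩)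
    · exact ⟨.inr (T.le_mem _ _ h).1, .inr (T.le_mem _ _ h).2⟩
    · exact ⟨.inl rfl, .inl rfl⟩
    · exact ⟨.inl rfl, .inr (T.le_mem _ _ h).2⟩
    · exact ⟨.inr (T.le_mem _ _ h).1, .inl rfl⟩
  le_refl := by
    rintro u (rfl | h)
    · exact .inr (.inl ⟨rfl, rfl⟩)
    · exact .inl (T.le_refl u h)
  le_trans := by
    have key : ∀ u v, T.le u v → u ≠ i ∧ v ≠ i := fun u v h =>
      ⟨fun hu => hi (hu ▸ (T.le_mem _ _ h).1), fun hv => hi (hv ▸ (T.le_mem _ _ h).2)⟩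
    rintro u v w (h | ⟨rfl, rfl⟩ | ⟨rfl, y, hc, hy, h⟩ | ⟨rfl, h, hu⟩) h'
    · rcases h' with h' | ⟨rfl, rfl⟩ | ⟨rfl, y', hc', hy', h'⟩ | ⟨rfl, h', hv⟩
      · exact .inl (T.le_trans _ _ _ h h')
      · exact absurd rfl (key _ _ h).2
      · exact absurd rfl (key _ _ h).2
      · exact .inr (.inr (.inr ⟨rfl, T.le_trans _ _ _ h h', (T.le_nat _ _ h).trans_lt hv⟩))
    · exact h'
    · rcases h' with h' | ⟨rfl, rfl⟩ | ⟨rfl, y', hc', hy', h'⟩ | ⟨rfl, h', hv⟩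
      · exact .inr (.inr (.inl ⟨rfl, y, hc, hy, T.le_trans _ _ _ h h'⟩))
      · exact .inr (.inl ⟨rfl, rfl⟩)
      · exact .inr (.inr (.inl ⟨rfl, y', hc', hy', h'⟩))
      · exact .inr (.inl ⟨rfl, rfl⟩)
    · rcases h' with h' | ⟨-, rfl⟩ | ⟨-, y', hc', hy', h'⟩ | ⟨rfl, h', hv⟩
      · exact absurd rfl (key _ _ h').1
      · exact .inr (.inr (.inr ⟨rfl, h, hu⟩))
      · rcases T.le_linear _ _ _ h hc' with h2 | h2
        · exact .inl (T.le_trans _ _ _ h2 h')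
        · exact absurd (T.le_nat _ _ h2) (by omega)
      · exact absurd hv (lt_irrefl _)
  le_linear := by
    -- An old predecessor of a node above `i` is itself comparable with `i`.
    have main : ∀ v k, (∃ y, T.le y c ∧ i < y ∧ T.le y k) → T.le v k →
        (∃ y, T.le y c ∧ i < y ∧ T.le y v) ∨ (T.le v c ∧ v < i) := by
      rintro v k ⟨y, hc, hy, h⟩ hv
      rcases T.le_linear _ _ _ h hv with h2 | h2
      · exact .inl ⟨y, hc, hy, h2⟩
      · have hvc := T.le_trans _ _ _ h2 hc
        have hv' := (T.le_mem _ _ hvc).1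
        rcases lt_trichotomy v i with h3 | h3 | h3
        · exact .inr ⟨hvc, h3⟩
        · exact absurd (h3 ▸ hv') hi
        · exact .inl ⟨v, hvc, h3, T.le_refl _ hv'⟩
    rintro u v w (h | ⟨rfl, rfl⟩ | ⟨rfl, h⟩ | ⟨rfl, h, hu⟩)
      (h' | ⟨rfl, hw⟩ | ⟨rfl, h'⟩ | ⟨hw, h', hv⟩)
    · exact (T.le_linear _ _ _ h h').imp .inl .inl
    · exact absurd (hw ▸ (T.le_mem _ _ h).2) hi
    · rcases main _ _ h' h with h2 | h2
      · exact .inr (.inr (.inr (.inl ⟨rfl, h2⟩)))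
      · exact .inl (.inr (.inr (.inr ⟨rfl, h2⟩)))
    · exact absurd (hw ▸ (T.le_mem _ _ h).2) hi
    · exact absurd (T.le_mem _ _ h').2 hi
    · exact .inl (.inr (.inl ⟨rfl, rfl⟩))
    · exact .inl (.inr (.inl ⟨rfl, rfl⟩))
    · exact .inr (.inr (.inr (.inr ⟨rfl, h', hv⟩)))
    · rcases main _ _ h h' with h2 | h2
      · exact .inl (.inr (.inr (.inl ⟨rfl, h2⟩)))
      · exact .inr (.inr (.inr (.inr ⟨rfl, h2⟩)))
    · exact .inl (.inr (.inl ⟨rfl, rfl⟩))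
    · exact .inl (.inr (.inl ⟨rfl, rfl⟩))
    · exact .inr (.inr (.inr (.inr ⟨rfl, h', hv⟩)))
    · exact absurd (T.le_mem _ _ h').2 hi
    · exact .inl (.inr (.inr (.inr ⟨rfl, h, hu⟩)))
    · exact .inl (.inr (.inr (.inr ⟨rfl, h, hu⟩)))
    · exact (T.le_linear _ _ _ h h').imp .inl .inl
  le_nat := by
    rintro u v (h | ⟨rfl, rfl⟩ | ⟨rfl, y, -, hy, h⟩ | ⟨rfl, -, hu⟩)
    · exact T.le_nat _ _ h
    · exact le_rfl
    · exact hy.le.trans (T.le_nat _ _ h)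
    · exact hu.le

theorem insertBelow_le_iff {T : NatTree} {i c : ℕ} (hi : i ∉ T.carrier) {u v : ℕ}
    (hu : u ∈ T.carrier) (hv : v ∈ T.carrier) : (T.insertBelow i c hi).le u v ↔ T.le u v := by
  refine ⟨?_, .inl⟩
  rintro (h | ⟨rfl, -⟩ | ⟨rfl, -⟩ | ⟨rfl, -⟩)
  · exact h
  · exact absurd hu hi
  · exact absurd hu hi
  · exact absurd hv hi

/-- Removing `i` from a branch of the new tree leaves a branch of `T`. It stays cofinal because `i`,
lying below `c`, is never the top of a branch. -/
theorem insertBelow_extends {T : NatTree} {i c : ℕ} (hi : i ∉ T.carrier) (hc : c ∈ T.carrier)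
    (hic : i < c) : (T.insertBelow i c hi).Extends T := by
  set T' := T.insertBelow i c hi with hT'
  refine ⟨Set.subset_insert _ _, fun u hu v hv => (insertBelow_le_iff hi hu hv).symm,
    fun B hB => ?_⟩
  have chain_iff : ∀ d ⊆ T.carrier, IsChain T'.le d ↔ IsChain T.le d := fun d hd =>
    ⟨fun h u hu v hv huv => (h hu hv huv).imp (insertBelow_le_iff hi (hd hu) (hd hv)).1
      (insertBelow_le_iff hi (hd hv) (hd hu)).1,
     fun h u hu v hv huv => (h hu hv huv).imp .inl .inl⟩
  have hb : B ∩ T.carrier ⊆ T.carrier ∧ IsChain T.le (B ∩ T.carrier) :=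
    ⟨Set.inter_subset_right, (chain_iff _ Set.inter_subset_right).1
      (hB.prop.2.mono Set.inter_subset_left)⟩
  -- an element of `B` above `i`
  have habove : i ∈ B → ∃ v ∈ B, v ∈ T.carrier ∧ T'.le i v := by
    intro hiB
    have hicc : T'.le i c := .inr (.inr (.inl ⟨rfl, c, T.le_refl c hc, hic, T.le_refl c hc⟩))
    -- Otherwise `i` is the top of `B`, so all of `B` lies below `c` and maximality puts `c` into
    -- `B`.
    by_contra! hno
    have hle : ∀ u ∈ B, T'.le u c := by
      intro u hu
      by_cases hui : u = i
      · exact hui ▸ hicc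
      rcases hB.prop.2 hu hiB hui with h | h
      · exact T'.le_trans _ _ _ h hicc
      · exact absurd h (hno u hu ((hB.prop.1 hu).resolve_left hui))
    have hins : insert c B ⊆ T'.carrier ∧ IsChain T'.le (insert c B) :=
      ⟨Set.insert_subset (.inr hc) hB.prop.1, hB.prop.2.insert fun u hu _ => .inr (hle u hu)⟩
    exact hno c (hB.le_of_ge hins (Set.subset_insert _ _) (Set.mem_insert _ _)) hc hicc
  have hmax : T.IsBranch (B ∩ T.carrier) := by
    refine ⟨hb, fun d hd hbd u hu => ⟨?_, hd.1 hu⟩⟩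
    by_cases hiB : i ∈ B
    · obtain ⟨v, hvB, hvT, hiv⟩ := habove hiB
      have hvd : v ∈ d := hbd ⟨hvB, hvT⟩
      have hch : insert i d ⊆ T'.carrier ∧ IsChain T'.le (insert i d) := by
        refine ⟨Set.insert_subset_insert hd.1, ((chain_iff d hd.1).2 hd.2).insert
          fun w hw _ => ?_⟩
        by_cases hwv : w = v
        · exact .inl (hwv ▸ hiv)
        rcases hd.2 hw hvd hwv with h | h
        · exact T'.le_linear _ _ _ hiv (.inl h)
        · exact .inl (T'.le_trans _ _ _ hiv (.inl h))
      refine hB.le_of_ge hch (fun w hw => ?_) (.inr hu)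
      rcases hB.prop.1 hw with h | h
      · exact .inl h
      · exact .inr (hbd ⟨hw, h⟩)
    · have hBT : B ⊆ T.carrier := fun w hw =>
        (hB.prop.1 hw).resolve_left fun h => hiB (h ▸ hw)
      exact hB.le_of_ge ⟨hd.1.trans (Set.subset_insert _ _), (chain_iff d hd.1).2 hd.2⟩
        (fun w hw => hbd ⟨hw, hBT hw⟩) hu
  refine ⟨B ∩ T.carrier, ⟨hmax, Set.inter_subset_left, fun u hu => ?_⟩, ?_⟩
  · rcases hB.prop.1 hu with rfl | h
    · obtain ⟨v, hvB, hvT, hv⟩ := habove hu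
      exact ⟨v, ⟨hvB, hvT⟩, hv⟩
    · exact ⟨u, ⟨hu, h⟩, T'.le_refl u (hB.prop.1 hu)⟩
  · rintro d ⟨hd, hdB, -⟩
    have hsub : d ⊆ B ∩ T.carrier := fun w hw => ⟨hdB hw, hd.prop.1 hw⟩
    exact hsub.antisymm (hd.le_of_ge hb hsub)

end NatTree

/-! ### Extending a condition along a branch. -/

namespace PForcing

variable {F : Filter ℕ} {T₀ : NatTree} {e : List Bool → ℕ}

open NatTree

theorem exists_insert (hF : F ≤ Filter.cofinite) (he : Set.BijOn e Set.univ T₀.carrier)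
    (hle : ∀ s t, T₀.le (e s) (e t) ↔ s <+: t) (x : ℕ → Bool) (p : PForcing F T₀) {i : ℕ}
    (hi : i ∉ p.tree.carrier) :
    ∃ q ≤ p, q.tree.carrier = insert i p.tree.carrier ∧ i ∈ q.tree.below (path e x) := by
  classical
  obtain ⟨m, hm⟩ := p.ext
  -- The node at level `j` exceeds both `m`, hence is in the tree, and `i`, hence can serve as the
  -- target of the insertion.
  set j := max m i + 1 with hj
  have hjle : j ≤ path e x j := (path_strictMono he hle x).le_apply
  have hc : path e x j ∈ p.tree.carrier := hm.1 ⟨path_mem he x j, by omega⟩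
  have hext := insertBelow_extends hi hc (by omega : i < path e x j)
  have hfin : ({i} : Set ℕ)ᶜ ∈ F := hF (Set.finite_singleton i).compl_mem_cofinite
  have hcar : (p.tree.insertBelow i (path e x j) hi).carrier = insert i p.tree.carrier := rfl
  refine ⟨⟨p.tree.insertBelow i (path e x j) hi, ?_, ⟨m, hext.trans hm⟩,
    fun k => if h : k.1 ∈ p.tree.carrier then p.f ⟨k.1, h⟩ else false⟩, ⟨hext, ?_⟩, hcar,
    j, fun k hk => ?_⟩
  · rw [hcar, Set.insert_eq, Set.compl_union]
    exact Filter.inter_mem hfin p.small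
  · intro k _ hk
    simp [hk]
  · exact .inr (.inr (.inl ⟨rfl, path e x j, p.tree.le_refl _ hc, by omega,
      path_le he hle hm x (by omega) hk⟩))

theorem exists_insert_finset (hF : F ≤ Filter.cofinite)
    (he : Set.BijOn e Set.univ T₀.carrier) (hle : ∀ s t, T₀.le (e s) (e t) ↔ s <+: t)
    (x : ℕ → Bool) (p : PForcing F T₀) (K : Finset ℕ) (hK : ∀ i ∈ K, i ∉ p.tree.carrier) :
    ∃ q ≤ p, ∀ i ∈ K, i ∈ q.tree.below (path e x) := by
  classical
  -- The induction must control the carrier, so that the next number is still new.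
  suffices h : ∃ q ≤ p, q.tree.carrier ⊆ p.tree.carrier ∪ K ∧
      ∀ i ∈ K, i ∈ q.tree.below (path e x) by
    obtain ⟨q, hq, -, h⟩ := h
    exact ⟨q, hq, h⟩
  induction K using Finset.induction_on with
  | empty => exact ⟨p, le_rfl, by simp, by simp⟩
  | insert i K hiK ih =>
    obtain ⟨q, hqp, hcar, hq⟩ := ih fun k hk => hK k (Finset.mem_insert_of_mem hk)
    have hi : i ∉ q.tree.carrier := fun h =>
      (hcar h).elim (hK i (Finset.mem_insert_self _ _)) (fun h => hiK h)
    obtain ⟨q', hq'q, hcar', hiq'⟩ := exists_insert hF he hle x q hi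
    refine ⟨q', hq'q.trans hqp, ?_, fun k hk => ?_⟩
    · rw [hcar']
      rintro k (rfl | hk)
      · simp
      · rcases hcar hk with h | h
        · exact .inl h
        · exact .inr (by simp [Finset.mem_coe.1 h])
    · rcases Finset.mem_insert.1 hk with rfl | hk
      · exact hiq'
      · exact below_mono hq'q.1 _ (hq k hk)

end PForcing

/-! ### Complete embeddings. -/

namespace IsCompleteEmbedding

variable {Q R : Type*} [Preorder Q] [Preorder R] {e : Q → R}

theorem exists_le (he : IsCompleteEmbedding e) (r : R) : ∃ s ≤ r, ∃ q, s ≤ e q := by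
  obtain ⟨q, hq⟩ := he.reduction r
  obtain ⟨s, hs, hs'⟩ := hq q le_rfl
  exact ⟨s, hs', q, hs⟩

/-- Three conditions in the generic filter have a common extension. -/
theorem exists_common (he : IsCompleteEmbedding e) {r : R} {q₁ q₂ q₃ : Q} (h₁ : r ≤ e q₁)
    (h₂ : r ≤ e q₂) (h₃ : r ≤ e q₃) : ∃ q, q ≤ q₁ ∧ q ≤ q₂ ∧ q ≤ q₃ := by
  obtain ⟨q, hq⟩ := he.reduction r
  have step : ∀ s ≤ q, ∀ q', r ≤ e q' → ∃ t, t ≤ s ∧ t ≤ q' := by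
    intro s hs q' hq'
    by_contra hcon
    refine he.incompat s q' hcon ?_
    obtain ⟨u, hu, hu'⟩ := hq s hs
    exact ⟨u, hu, hu'.trans hq'⟩
  obtain ⟨s₁, ha, hb⟩ := step q le_rfl q₁ h₁
  obtain ⟨s₂, hc, hd⟩ := step s₁ ha q₂ h₂
  obtain ⟨s₃, hf, hg⟩ := step s₂ (hc.trans ha) q₃ h₃
  exact ⟨s₃, (hf.trans hc).trans hb, hf.trans hd, hg⟩

end IsCompleteEmbedding

/-! ### Basic facts about forced statements. -/

namespace Forcing

section Basic

variable {R : Type*} [Preorder R]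

theorem mem_mono {α : Type*} {a : α} {τ : SetName R α} {p q : R} (h : mem a τ p) (hq : q ≤ p) :
    mem a τ q := fun s hs => h s (hs.trans hq)

theorem mem_of_pair {α : Type*} {a : α} {τ : SetName R α} {p s : R} (h : (a, s) ∈ τ)
    (hp : p ≤ s) : mem a τ p := fun q hq => ⟨q, le_rfl, s, h, hq.trans hp⟩

theorem mem_check {α : Type*} {a : α} {A : Set α} {p : R} : mem a (check A) p ↔ a ∈ A := by
  constructor
  · intro h
    obtain ⟨_, _, _, h, _⟩ := h p le_rfl
    exact h
  · intro h
    exact mem_of_pair (s := p) h le_rfl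

theorem eq_mono {σ τ : SetName R ℕ} {p q : R} (h : eq σ τ p) (hq : q ≤ p) : eq σ τ q :=
  ⟨fun i s hs => h.1 i s (hs.trans hq), fun i s hs => h.2 i s (hs.trans hq)⟩

theorem eq_refl (σ : SetName R ℕ) (p : R) : eq σ σ p := ⟨fun _ _ _ h => h, fun _ _ _ h => h⟩

theorem eq_symm {σ τ : SetName R ℕ} {p : R} (h : eq σ τ p) : eq τ σ p := ⟨h.2, h.1⟩

theorem eq_trans {σ τ ρ : SetName R ℕ} {p : R} (h : eq σ τ p) (h' : eq τ ρ p) : eq σ ρ p :=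
  ⟨fun i s hs hi => h'.1 i s hs (h.1 i s hs hi), fun i s hs hi => h.2 i s hs (h'.2 i s hs hi)⟩

theorem memFamily_mono {σ : SetName R ℕ} {E : FamilyName R} {p q : R} (h : memFamily σ E p)
    (hq : q ≤ p) : memFamily σ E q := fun s hs => h s (hs.trans hq)

theorem memFamily_of_dense {σ : SetName R ℕ} {E : FamilyName R} {p : R}
    (h : ∀ q ≤ p, ∃ r ≤ q, memFamily σ E r) : memFamily σ E p := by
  intro q hq
  obtain ⟨r, hr, hr'⟩ := h q hq
  obtain ⟨s, hs, h⟩ := hr' r le_rfl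
  exact ⟨s, hs.trans hr, h⟩

theorem memFamily_check_ge {E : FamilyName R} {r : R} (hE : isFilter E r) (N : ℕ) :
    memFamily (check {i | N ≤ i}) E r :=
  hE.1 _ r le_rfl fun q _ => ⟨q, le_rfl, N, fun _ _ _ hi _ _ _ => mem_check.2 hi⟩

theorem exists_mem_inter {E : FamilyName R} {r s : R} (hE : isFilter E r) (hs : s ≤ r)
    {σ τ : SetName R ℕ} (hσ : memFamily σ E s) (hτ : memFamily τ E s) :
    ∃ t ≤ s, ∃ ρ, memFamily ρ E t ∧ sub ρ σ t ∧ sub ρ τ t :=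
  hE.2.2.1 σ τ s hs hσ s le_rfl hτ s le_rfl

theorem exists_nat_mem {E : FamilyName R} {r s : R} (hE : isFilter E r) (hs : s ≤ r)
    {σ : SetName R ℕ} (hσ : memFamily σ E s) : ∃ t ≤ s, ∃ i, mem i σ t :=
  hE.2.2.2 σ s hs hσ s le_rfl

theorem positive_mono {E : FamilyName R} {σ : SetName R ℕ} {p q : R} (h : positive E σ p)
    (hq : q ≤ p) : positive E σ q := fun ρ s hs => h ρ s (hs.trans hq)

/-- A name for the complement. -/
def compl (σ : SetName R ℕ) : SetName R ℕ := {x | ∀ t ≤ x.2, ¬ mem x.1 σ t}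

theorem not_mem_of_mem_compl {σ : SetName R ℕ} {i : ℕ} {p : R} (h : mem i (compl σ) p) :
    ¬ mem i σ p := by
  intro h'
  obtain ⟨r, hr, s, hs, hrs⟩ := h p le_rfl
  exact hs r hrs (mem_mono h' hr)

/-- If `σ` is nowhere forced to be positive, its complement is forced to be in the filter. -/
theorem memFamily_compl {E : FamilyName R} {r p : R} (hE : isFilter E r) (hp : p ≤ r)
    {σ : SetName R ℕ} (h : ∀ s ≤ p, ¬ positive E σ s) : memFamily (compl σ) E p := by
  refine memFamily_of_dense fun s hs => ?_
  have := h s hs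
  simp only [positive, all, imp, ex, and] at this
  push Not at this
  -- Below `q'` no number is forced into both `ρ` and `σ`, so the filter member `ρ` is contained in
  -- the complement of `σ`.
  obtain ⟨ρ, q, hq, hρ, q', hq', hno⟩ := this
  refine ⟨q', hq'.trans hq, hE.2.1 ρ (compl σ) q' (((hq'.trans hq).trans hs).trans hp)
    (memFamily_mono hρ hq') q' le_rfl ?_⟩
  intro i t ht hi
  exact mem_of_pair (s := t) (fun u hu => hno u (hu.trans ht) i (mem_mono hi hu)) le_rfl

/-! ### Consequences of bounding, and antichains. -/

/-- Bounding functions of the ground model, for a statement about natural numbers. -/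
theorem exists_bound (hR : IsOmegaBounding R) {φ : ℕ → ℕ → R → Prop}
    (hmono : ∀ n k s t, φ n k s → t ≤ s → φ n k t)
    (hup : ∀ n k k' s, k ≤ k' → φ n k s → φ n k' s) {r : R}
    (hdense : ∀ n, ∀ q ≤ r, ∃ s ≤ q, ∃ k, φ n k s) :
    ∃ s ≤ r, ∃ h : ℕ → ℕ, ∃ k₀, ∀ n ≥ k₀, ∀ q ≤ s, ∃ t ≤ q, φ n (h n) t := by
  classical
  -- A name for the function taking `n` to the least `k` that works; minimality makes it
  -- single-valued.
  let f : SetName R (ℕ × ℕ) := {x | φ x.1.1 x.1.2 x.2 ∧ ∀ k < x.1.2, ∀ s ≤ x.2, ¬ φ x.1.1 k s}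
  have htot : ∀ n, ∀ q ≤ r, ∃ s ≤ q, ∃ m, mem (n, m) f s := by
    intro n q hq
    have hex : ∃ k, ∃ s ≤ q, φ n k s := by
      obtain ⟨s, hs, k, h⟩ := hdense n q hq
      exact ⟨k, s, hs, h⟩
    obtain ⟨s, hs, h⟩ := Nat.find_spec hex
    refine ⟨s, hs, Nat.find hex, mem_of_pair (s := s) ⟨h, fun k hk t ht h' => ?_⟩ le_rfl⟩
    exact Nat.find_min hex hk ⟨t, ht.trans hs, h'⟩
  have hfun : isFunction f r := by
    refine ⟨fun n q hq => htot n q hq, fun n m k q _ hm q' hq' hk => ?_⟩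
    obtain ⟨s, hs, w, hw, hsw⟩ := hm q' hq'
    obtain ⟨t, ht, v, hv, htv⟩ := hk s hs
    have h1 := hmono _ _ _ t hw.1 (ht.trans hsw)
    have h2 := hmono _ _ _ t hv.1 htv
    refine le_antisymm ?_ ?_
    · exact not_lt.1 fun hlt => hw.2 k hlt t (ht.trans hsw) h2
    · exact not_lt.1 fun hlt => hv.2 m hlt t htv h1
  obtain ⟨s, hs, g, hg⟩ := hR r f r le_rfl hfun r le_rfl
  obtain ⟨s', hs', k₀, hk₀⟩ := hg s le_rfl
  refine ⟨s', hs'.trans hs, g, k₀, fun n hn q hq => ?_⟩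
  obtain ⟨t, ht, m, hm⟩ := htot n q ((hq.trans hs').trans hs)
  have hmg : m ≤ g n := hk₀ n m q hq hn t ht hm
  obtain ⟨u, hu, w, hw, huw⟩ := hm t le_rfl
  exact ⟨u, hu.trans ht, hup _ _ _ _ hmg (hmono _ _ _ _ hw.1 huw)⟩

/-- Both sets have the cardinality of the continuum. Thus a function escaping a list can be read
back as a real. -/
theorem exists_surjective_reals : ∃ G : (ℕ → Bool) → ℕ → ℕ, Function.Surjective G := by
  have h : Cardinal.mk (ℕ → Bool) = Cardinal.mk (ℕ → ℕ) := by simp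
  obtain ⟨G⟩ := Cardinal.eq.1 h
  exact ⟨G, G.surjective⟩

/-- The reals of the ground model remain uncountable in a bounding extension: if `D s m x`
says that `s` decides the `m`-th real of some enumeration to be `x`, then some real is omitted. -/
theorem exists_real_omitted (hR : IsOmegaBounding R) {D : R → ℕ → (ℕ → Bool) → Prop}
    (hcons : ∀ s s' t m x y, D s m x → D s' m y → t ≤ s → t ≤ s' → x = y)
    (hmono : ∀ s t m x, D s m x → t ≤ s → D t m x) (r : R) :
    ∃ s ≤ r, ∃ x, ∀ t ≤ s, ∀ m, ¬ D t m x := by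
  obtain ⟨G, hG⟩ := exists_surjective_reals
  -- Diagonalisation: `v` exceeds the values at `j` of the first `j` listed reals. A bound `h` for
  -- `v` eventually exceeds each listed real, so a real coded by `h` itself is not listed.
  let φ : ℕ → ℕ → R → Prop := fun j v s => ∀ m < j, ∀ t ≤ s, ∀ x, D t m x → G x j < v
  have hdense : ∀ j, ∀ q ≤ r, ∃ s ≤ q, ∃ v, φ j v s := by
    intro j q _
    suffices h : ∀ l, ∃ s ≤ q, ∃ v, ∀ m < l, ∀ t ≤ s, ∀ x, D t m x → G x j < v from h j
    intro l
    induction l with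
    | zero => exact ⟨q, le_rfl, 0, by simp⟩
    | succ l ih =>
      obtain ⟨s, hs, v, hv⟩ := ih
      by_cases h : ∃ t ≤ s, ∃ x, D t l x
      · obtain ⟨t, ht, x, hx⟩ := h
        refine ⟨t, ht.trans hs, max v (G x j + 1), fun m hm u hu y hy => ?_⟩
        rcases Nat.lt_succ_iff_lt_or_eq.1 hm with hm | rfl
        · exact lt_max_of_lt_left (hv m hm u (hu.trans ht) y hy)
        · rw [hcons t u u m x y hx hy hu le_rfl]
          exact lt_max_of_lt_right (Nat.lt_succ_self _)
      · push Not at h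
        refine ⟨s, hs, v, fun m hm u hu y hy => ?_⟩
        rcases Nat.lt_succ_iff_lt_or_eq.1 hm with hm | rfl
        · exact hv m hm u hu y hy
        · exact absurd hy (h u hu y)
  obtain ⟨s, hs, h, k₀, hk⟩ := exists_bound hR (φ := φ)
    (fun _ _ _ _ hφ ht m hm u hu => hφ m hm u (hu.trans ht))
    (fun _ _ _ _ hkk' hφ m hm u hu x hx => (hφ m hm u hu x hx).trans_le hkk') hdense
  obtain ⟨x, hx⟩ := hG h
  refine ⟨s, hs, x, fun t ht m hD => ?_⟩
  obtain ⟨u, hu, hφ⟩ := hk (max k₀ (m + 1)) (le_max_left _ _) t ht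
  have := hφ m (by omega) u le_rfl x (hmono _ _ _ _ hD hu)
  rw [hx] at this
  exact lt_irrefl _ this

/-- A set of conditions dense below `r` contains an antichain that is predense below `r`. -/
theorem exists_antichain (r : R) {D : R → Prop} (hD : ∀ q ≤ r, ∃ s ≤ q, D s) :
    ∃ W : Set R, (∀ w ∈ W, D w) ∧ (∀ w ∈ W, ∀ w' ∈ W, ∀ s, s ≤ w → s ≤ w' → w = w') ∧
      ∀ q ≤ r, ∃ w ∈ W, ∃ s, s ≤ q ∧ s ≤ w := by
  obtain ⟨W, hW⟩ := zorn_subset {W : Set R | (∀ w ∈ W, D w) ∧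
      ∀ w ∈ W, ∀ w' ∈ W, ∀ s, s ≤ w → s ≤ w' → w = w'} <| by
    intro c hc hch
    refine ⟨⋃₀ c, ⟨fun w ⟨C, hC, hw⟩ => (hc hC).1 w hw, ?_⟩,
      fun C hC => Set.subset_sUnion_of_mem hC⟩
    rintro w ⟨C, hC, hw⟩ w' ⟨C', hC', hw'⟩
    rcases hch.total hC hC' with h | h
    · exact (hc hC').2 w (h hw) w' hw'
    · exact (hc hC).2 w hw w' (h hw')
  refine ⟨W, hW.prop.1, hW.prop.2, fun q hq => ?_⟩
  by_contra! hno
  obtain ⟨s, hs, hDs⟩ := hD q hq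
  have hins : insert s W ⊆ W := by
    refine hW.le_of_ge ⟨?_, ?_⟩ (Set.subset_insert _ _)
    · rintro w (rfl | hw)
      · exact hDs
      · exact hW.prop.1 w hw
    · rintro w (rfl | hw) w' (rfl | hw') t ht ht'
      · rfl
      · exact absurd ht' (hno w' hw' t (ht.trans hs))
      · exact absurd ht (hno w hw t (ht'.trans hs))
      · exact hW.prop.2 w hw w' hw' t ht ht'
  exact hno s (hins (Set.mem_insert _ _)) s hs le_rfl

end Basic

/-! ### Branches of the generic trees. -/

section Generic

variable {R : Type*} [Preorder R] {F : Filter ℕ} {T₀ : NatTree}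

open NatTree

/-- The name of the branch along `b` of the `n`-th generic tree. -/
def branchName (e : QForcing F T₀ → R) (n : ℕ) (b : ℕ → ℕ) : SetName R ℕ :=
  {x | ∃ q, x.2 = e q ∧ x.1 ∈ (q n).tree.below b}

variable {e : QForcing F T₀ → R} {e₀ : List Bool → ℕ}

/-- One condition `q` fixes the `m` for its `n`-th tree, and the bound of `below_inter_bounded`
depends only on `m`. Any two conditions putting `i` on the branches have a common extension with
`q`, so the bound applies to `i`. -/
theorem branchName_inter_bounded (he : IsCompleteEmbedding e)
    (hb : Set.BijOn e₀ Set.univ T₀.carrier) (hle : ∀ s t, T₀.le (e₀ s) (e₀ t) ↔ s <+: t)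
    {x y : ℕ → Bool} (hxy : x ≠ y) (n : ℕ) (r : R) :
    ∃ s ≤ r, ∃ N, ∀ t ≤ s, ∀ i, mem i (branchName e n (path e₀ x)) t →
      mem i (branchName e n (path e₀ y)) t → i < N := by
  obtain ⟨s, hs, q, hq⟩ := he.exists_le r
  obtain ⟨m, hm⟩ := (q n).ext
  obtain ⟨N, hN⟩ := below_inter_bounded hb hle hxy m
  refine ⟨s, hs, N, fun t ht i hx hy => ?_⟩
  obtain ⟨u, hu, _, ⟨q₁, rfl, h₁⟩, hu'⟩ := hx t le_rfl
  obtain ⟨v, hv, _, ⟨q₂, rfl, h₂⟩, hv'⟩ := hy u hu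
  obtain ⟨q₃, h3, h31, h32⟩ := he.exists_common (((hv.trans hu).trans ht).trans hq)
    (hv.trans hu') hv'
  exact hN _ ((h3 n).1.trans hm) i (below_mono (h31 n).1 _ h₁) (below_mono (h32 n).1 _ h₂)

/-- The `E`-positive branches of the `n`-th generic tree that come from the ground model. -/
def positiveBranches (E : FamilyName R) (e : QForcing F T₀ → R) (e₀ : List Bool → ℕ) (n : ℕ) :
    FamilyName R :=
  {z | ∃ x, z.1 = branchName e n (path e₀ x) ∧ positive E z.1 z.2}

theorem countable_positiveBranches (he : IsCompleteEmbedding e)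
    (hb : Set.BijOn e₀ Set.univ T₀.carrier) (hle : ∀ s t, T₀.le (e₀ s) (e₀ t) ↔ s <+: t)
    {E : FamilyName R} {r : R} (hE : isFilter E r) (hccc : isCcc E r) (n : ℕ) :
    countable (positiveBranches E e e₀ n) r := by
  refine hccc _ r le_rfl ?_ r le_rfl ?_
  · intro σ q _ hσ ρ q' hq' hρ q'' hq''
    obtain ⟨t, ht, _, s, ⟨x, rfl, hpos⟩, hts, heq⟩ := hσ q'' (hq''.trans hq')
    obtain ⟨u, hu, i, hi, hi'⟩ := hpos ρ t hts (memFamily_mono hρ (ht.trans hq'')) t le_rfl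
    exact ⟨u, hu.trans ht, i, hi, heq.2 i u hu hi'⟩
  · intro σ τ q hq hσ q' hq' hτ q'' hq'' hne u hu
    obtain ⟨t, ht, _, s, ⟨x, rfl, -⟩, -, hx⟩ := hσ u ((hu.trans hq'').trans hq')
    obtain ⟨t', ht', _, s', ⟨y, rfl, -⟩, -, hy⟩ := hτ t ((ht.trans hu).trans hq'')
    have hxy : x ≠ y := by
      rintro rfl
      exact hne t' ((ht'.trans ht).trans hu) (eq_trans (eq_mono hx ht') (eq_symm hy))
    obtain ⟨v, hv, N, hN⟩ := branchName_inter_bounded he hb hle hxy n t'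
    have hvu : v ≤ u := (hv.trans ht').trans ht
    refine ⟨v, hvu, check {i | N ≤ i}, memFamily_mono (memFamily_check_ge hE N)
      ((((hvu.trans hu).trans hq'').trans hq').trans hq), ?_⟩
    rintro i w hw ⟨h1, h2, h3⟩
    exact absurd (hN w hw i (hx.1 i w ((hw.trans hv).trans ht') h2) (hy.1 i w (hw.trans hv) h3))
      (not_lt.2 (mem_check.1 h1))

/-- Some ground model branch is in the dual ideal of `E` in all the generic trees. -/
theorem exists_null_branch (hR : IsOmegaBounding R) (he : IsCompleteEmbedding e)
    (hb : Set.BijOn e₀ Set.univ T₀.carrier) (hle : ∀ s t, T₀.le (e₀ s) (e₀ t) ↔ s <+: t)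
    {E : FamilyName R} {r : R} (hE : isFilter E r) (hccc : isCcc E r) :
    ∃ s ≤ r, ∃ x, ∀ n, memFamily (compl (branchName e n (path e₀ x))) E s := by
  let C : ℕ → (ℕ → SetName R ℕ) → R → Prop := fun n ν w => w ≤ r ∧
    (all fun σ => imp (memFamily σ (positiveBranches E e e₀ n)) (ex fun k => eq σ (ν k))) w
  -- Enumerations exist only densely, separately for each `n`. Indexing them by an antichain avoids
  -- a common extension for infinitely many `n`.
  have hW : ∀ n, ∃ W : Set R, (∀ w ∈ W, ∃ ν, C n ν w) ∧
      (∀ w ∈ W, ∀ w' ∈ W, ∀ s, s ≤ w → s ≤ w' → w = w') ∧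
      ∀ q ≤ r, ∃ w ∈ W, ∃ s, s ≤ q ∧ s ≤ w := fun n => exists_antichain r fun q hq => by
    obtain ⟨s, hs, ν, hν⟩ := countable_positiveBranches he hb hle hE hccc n q hq
    exact ⟨s, hs, ν, hs.trans hq, hν⟩
  choose W hWC hWanti hWdense using hW
  have hex : ∀ n w, ∃ ν, w ∈ W n → C n ν w := fun n w => by
    by_cases hw : w ∈ W n
    · exact (hWC n w hw).imp fun _ h _ => h
    · exact ⟨fun _ => ∅, fun h => absurd h hw⟩
  choose ν hν using hex
  -- The index `m` codes a tree and a position in its enumeration, so all trees are treated in one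
  -- list of reals.
  let D : R → ℕ → (ℕ → Bool) → Prop := fun s m x => ∃ w ∈ W m.unpair.1, s ≤ w ∧
    eq (branchName e m.unpair.1 (path e₀ x)) (ν m.unpair.1 w m.unpair.2) s ∧
    positive E (branchName e m.unpair.1 (path e₀ x)) s
  have hmono : ∀ s t m x, D s m x → t ≤ s → D t m x := by
    rintro s t m x ⟨w, hw, hsw, heq, hpos⟩ ht
    exact ⟨w, hw, ht.trans hsw, eq_mono heq ht, positive_mono hpos ht⟩
  have hcons : ∀ s s' t m x y, D s m x → D s' m y → t ≤ s → t ≤ s' → x = y := by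
    intro s s' t m x y hx hy hs hs'
    obtain ⟨w, hw, hsw, heq, hpos⟩ := hmono _ _ _ _ hx hs
    obtain ⟨w', hw', hsw', heq', -⟩ := hmono _ _ _ _ hy hs'
    obtain rfl := hWanti _ w hw w' hw' t hsw hsw'
    -- Both branches equal the same listed set, so that set is positive yet bounded by `N`, against
    -- the tail above `N` being in `E`.
    by_contra hxy
    obtain ⟨u, hu, N, hN⟩ := branchName_inter_bounded he hb hle hxy m.unpair.1 t
    obtain ⟨v, hv, i, hi, hi'⟩ := hpos (check {i | N ≤ i}) u hu (memFamily_mono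
      (memFamily_check_ge hE N) (hu.trans (hsw.trans (hν _ w hw).1))) u le_rfl
    exact absurd (hN v hv i hi' ((eq_trans heq (eq_symm heq')).1 i v (hv.trans hu) hi'))
      (not_lt.2 (mem_check.1 hi))
  obtain ⟨s, hs, x, hx⟩ := exists_real_omitted hR hcons hmono r
  refine ⟨s, hs, x, fun n => memFamily_compl hE hs fun t ht hpos => ?_⟩
  obtain ⟨w, hw, u, hut, huw⟩ := hWdense n t (ht.trans hs)
  have hmem : memFamily (branchName e n (path e₀ x)) (positiveBranches E e e₀ n) u := fun q hq =>
    ⟨q, le_rfl, _, t, ⟨x, rfl, hpos⟩, hq.trans hut, eq_refl _ _⟩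
  obtain ⟨v, hv, k, hk⟩ := (hν n w hw).2 _ u huw hmem u le_rfl
  refine hx v ((hv.trans hut).trans ht) (Nat.pair n k) ?_
  simp only [D, Nat.unpair_pair]
  exact ⟨w, hw, hv.trans huw, hk, positive_mono hpos (hv.trans hut)⟩

/-- Any condition has an extension forcing that, for a suitable `B ∈ F` and intervals
`[a n, a (n + 1))` beginning above `h n`, the `n`-th interval of `B` lies on the branch `x` of the
`n`-th generic tree. -/
theorem exists_intervals (hF : IsCccPFilter F) (he : IsCompleteEmbedding e)
    (hb : Set.BijOn e₀ Set.univ T₀.carrier) (hle : ∀ s t, T₀.le (e₀ s) (e₀ t) ↔ s <+: t)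
    (x : ℕ → Bool) (h : ℕ → ℕ) (r : R) :
    ∃ B ∈ F, ∃ a : ℕ → ℕ, StrictMono a ∧ (∀ n, h n ≤ a n) ∧ ∃ t ≤ r,
      ∀ n, ∀ i ∈ B, a n ≤ i → i < a (n + 1) → mem i (branchName e n (path e₀ x)) t := by
  classical
  obtain ⟨q, hq⟩ := he.reduction r
  obtain ⟨B, hB, hfin⟩ := hF.pseudo (fun n => (q n).tree.carrierᶜ) fun n => (q n).small
  choose c hc using fun n => (hfin n).bddAbove
  -- Partial sums make `a` increasing with `a n` above `h n` and `c n`; thus `B` beyond `a n` avoids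
  -- the `n`-th tree of `q`.
  let a : ℕ → ℕ := fun n => ∑ j ∈ Finset.range (n + 1), (h j + c j + 1)
  have ha : ∀ n, a (n + 1) = a n + (h (n + 1) + c (n + 1) + 1) := fun n =>
    Finset.sum_range_succ _ _
  have hac : ∀ n, h n + c n + 1 ≤ a n := fun n => by
    cases n with
    | zero => simp [a]
    | succ n => rw [ha]; omega
  have hK : ∀ n, ∃ q' ≤ q n, ∀ i ∈ (Finset.Ico (a n) (a (n + 1))).filter (· ∈ B),
      i ∈ q'.tree.below (path e₀ x) := fun n => by
    refine PForcing.exists_insert_finset hF.le_cofinite hb hle x (q n) _ fun i hi hiq => ?_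
    simp only [Finset.mem_filter, Finset.mem_Ico] at hi
    have h1 : i ≤ c n := hc n ⟨hi.2, fun hn => hn hiq⟩
    have h2 := hac n
    omega
  choose q' hq' hbelow using hK
  -- Full support allows all coordinates to be extended simultaneously; the reduction property then
  -- makes `e q'` compatible with `r`.
  obtain ⟨t, ht, htr⟩ := hq q' hq'
  refine ⟨B, hB, a, strictMono_nat_of_lt_succ fun n => by rw [ha]; omega,
    fun n => by have := hac n; omega, t, htr, fun n i hi h1 h2 => ?_⟩
  exact mem_of_pair (s := e q') ⟨q', rfl, hbelow n i (by simp [h1, h2, hi])⟩ ht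

end Generic

end Forcing

/-! ### The contradiction. -/

open Forcing in
theorem mainTheorem3 {R : Type*} [Preorder R] (F : Filter ℕ) (hF : IsCccPFilter F)
    (T₀ : NatTree) (hT₀ : T₀.carrierᶜ ∈ F) (hT₀' : T₀.IsFullBinary)
    (hR : Forcing.IsOmegaBounding R)
    (e : QForcing F T₀ → R) (he : IsCompleteEmbedding e) :
    ∀ p : R, Forcing.not (Forcing.ex fun E : Forcing.FamilyName R =>
      Forcing.and (Forcing.isCccPFilter E) (Forcing.extendsFilter F E)) p := by
  intro p p' _ hex
  obtain ⟨r, -, E, ⟨hE, hP, hccc⟩, hFE⟩ := hex p' le_rfl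
  obtain ⟨e₀, hb, hle⟩ := hT₀'
  obtain ⟨r₁, hr₁, x, hx⟩ := exists_null_branch hR he hb hle hE hccc
  obtain ⟨r₂, hr₂, ρ, hρE, hρ⟩ := hP _ r₁ hr₁ hx r₁ le_rfl
  let σ : ℕ → SetName R ℕ := fun n => branchName e n (NatTree.path e₀ x)
  obtain ⟨r₃, hr₃, h, k₀, hh⟩ := exists_bound hR (r := r₂)
    (φ := fun n k s => ∀ i ≥ k, ∀ t ≤ s, mem i ρ t → ¬ mem i (σ n) t)
    (fun _ _ _ _ hφ ht i hi u hu => hφ i hi u (hu.trans ht))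
    (fun _ _ _ _ hk hφ i hi => hφ i (hk.trans hi))
    (fun n q hq => by
      obtain ⟨s, hs, k, hk⟩ := hρ n q hq
      exact ⟨s, hs, k, fun i hi t ht hm => not_mem_of_mem_compl (hk i t ht hi t le_rfl hm)⟩)
  obtain ⟨B, hB, a, ha, hah, t, ht, hmem⟩ := exists_intervals hF he hb hle x h r₃
  have ht₂ : t ≤ r₂ := ht.trans hr₃
  have htr : t ≤ r := (ht₂.trans hr₂).trans hr₁
  have htE : ∀ A ∈ F, ∀ u ≤ r, memFamily (check A) E u := fun A hA u hu =>
    memFamily_mono (hFE ⟨A, hA⟩) hu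
  -- Find `i` in `ρ ∩ B` with `i ≥ a k₀`, so that its interval has index at least `k₀`, where `h` is
  -- a valid bound.
  obtain ⟨u, hu, ρ₁, hρ₁, h1, h2⟩ := exists_mem_inter hE htr (memFamily_mono hρE ht₂)
    (htE B hB t htr)
  obtain ⟨v, hv, ρ₂, hρ₂, h3, h4⟩ := exists_mem_inter hE (hu.trans htr) hρ₁
    (memFamily_mono (memFamily_check_ge hE (a k₀)) (hu.trans htr))
  obtain ⟨w, hw, i, hi⟩ := exists_nat_mem hE ((hv.trans hu).trans htr) hρ₂
  have hiρ₁ := h3 i w hw hi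
  have hiB : i ∈ B := mem_check.1 (h2 i w (hw.trans hv) hiρ₁)
  have hik : a k₀ ≤ i := mem_check.1 (h4 i w hw hi)
  have hiρ := h1 i w (hw.trans hv) hiρ₁
  have hwt : w ≤ t := (hw.trans hv).trans hu
  obtain ⟨n, hn, hn1, hn2⟩ : ∃ n ≥ k₀, a n ≤ i ∧ i < a (n + 1) := by
    have hP0 : ∃ n, i < a (n + 1) := ⟨i, (Nat.lt_succ_self i).trans_le ha.le_apply⟩
    classical
    have hk : k₀ ≤ Nat.find hP0 := by
      by_contra! hlt
      have h5 := Nat.find_spec hP0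
      have h6 : a (Nat.find hP0 + 1) ≤ a k₀ := ha.monotone hlt
      omega
    refine ⟨Nat.find hP0, hk, ?_, Nat.find_spec hP0⟩
    rcases hk.eq_or_lt with h5 | h5
    · rwa [← h5]
    · have h6 := Nat.find_min hP0 (Nat.sub_one_lt (by omega : Nat.find hP0 ≠ 0))
      rw [Nat.sub_add_cancel (by omega)] at h6
      omega
  obtain ⟨z, hz, hφ⟩ := hh n hn w (hwt.trans ht)
  exact hφ i ((hah n).trans hn1) z le_rfl (mem_mono hiρ hz)
    (mem_mono (hmem n i hiB hn1 hn2) (hz.trans hwt))
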